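/- Let $E$ be a real Banach space with dual $E^*$ and pairing $\langle\cdot,\cdot\rangle\colon E\times E^*\to\mathbb R$. For $S\colon E\rightrightarrows E^*$ put $G(S)=\{(x,x^*)\colon x^*\in Sx\}$ and $D(S)=\{x\in E\colon Sx\neq\emptyset\}$. Say that $S$ is closed if $G(S)$ is norm-closed in $E\times E^*$; monotone if $\langle x-y,x^*-y^*\rangle\ge 0$ for all $(x,x^*),(y,y^*)\in G(S)$; and quasidense if for all $(x,x^*)\in E\times E^*$ $$\inf_{(s,s^*)\in G(S)}\Big[\tfrac12\|s-x\|^2+\tfrac12\|s^*-x^*\|^2+\langle s-x,s^*-x^*\rangle\Big]\le 0$$ (with $\inf\emptyset=+\infty$). The Fitzpatrick function of a monotone $S$ with $G(S)\ne\emptyset$ is $$\varphi_S(x,x^*)=\sup_{(s,s^*)\in G(S)}\big[\langle s,x^*\rangle+\langle x,s^*\rangle-\langle s,s^*\rangle\big]\in\,]-\infty,\infty],$$ $\operatorname{dom}\varphi_S=\{b\in E\times E^*\colon\varphi_S(b)\in\mathbb R\}$, and $\pi_1(x,x^*)=x$. The sum is defined by $(S+T)x=\{u^*+v^*\colon u^*\in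 Sx,\ v^*\in Tx\}$. Theorem. Let $S,T\colon E\rightrightarrows E^*$ be closed, quasidense and monotone. Then (a) $\Rightarrow$ (b) $\Rightarrow$ (c) $\Rightarrow$ (d), where (a) $D(S)\cap\operatorname{int}D(T)\ne\emptyset$ or $\operatorname{int}D(S)\cap D(T)\ne\emptyset$; (b) $\bigcup_{\lambda>0}\lambda\,[D(S)-D(T)]=E$; (c) $\bigcup_{\lambda>0}\lambda\,[\pi_1\operatorname{dom}\varphi_S-\pi_1\operatorname{dom}\varphi_T]$ is a closed linear subspace of $E$; (d) $S+T$ is closed, quasidense and monotone. -/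

import Mathlib

open scoped Pointwise

/-- The quadratic form `q_L(x, x*) = ⟨x, x*⟩` on `E × E*`. -/
def qL {E : Type*} [NormedAddCommGroup E] [NormedSpace ℝ E]
    (a : E × StrongDual ℝ E) : ℝ := a.2 a.1

/-- The function `r_L(x, x*) = ½‖x‖² + ½‖x*‖² + ⟨x, x*⟩` on `E × E*`. -/
noncomputable def rL {E : Type*} [NormedAddCommGroup E] [NormedSpace ℝ E]
    (a : E × StrongDual ℝ E) : ℝ :=
  (1 / 2) * ‖a.1‖ ^ 2 + (1 / 2) * ‖a.2‖ ^ 2 + qL a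

/-- `A ⊆ E × E*` is quasidense if `inf r_L(A - c) ≤ 0` for every `c ∈ E × E*`.  The infimum is
taken in the extended reals, so that the infimum over the empty set is `+∞`. -/
def Quasidense {E : Type*} [NormedAddCommGroup E] [NormedSpace ℝ E]
    (A : Set (E × StrongDual ℝ E)) : Prop :=
  ∀ c : E × StrongDual ℝ E, (⨅ a ∈ A, ((rL (a - c) : ℝ) : EReal)) ≤ 0

/-- The effective domain of an extended-real-valued function: the points with a real value. -/
def effDom {X : Type*} (f : X → EReal) : Set X := {x | ∃ r : ℝ, f x = (r : EReal)}

/-- A multifunction `E ⇉ E*`.  The sum `S + T` of two of them is pointwise: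
`(S + T) x = {u + v | u ∈ S x, v ∈ T x}`. -/
abbrev Multifunction (E : Type*) [NormedAddCommGroup E] [NormedSpace ℝ E] : Type _ :=
  E → Set (StrongDual ℝ E)

namespace Multifunction

/-- The graph `G(S)`. -/
def graph {E : Type*} [NormedAddCommGroup E] [NormedSpace ℝ E]
    (S : Multifunction E) : Set (E × StrongDual ℝ E) := {a | a.2 ∈ S a.1}

/-- The domain `D(S) = {x | S x ≠ ∅}`. -/
def domain {E : Type*} [NormedAddCommGroup E] [NormedSpace ℝ E]
    (S : Multifunction E) : Set E := {x | (S x).Nonempty}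

/-- `S` is closed if its graph is (norm) closed in `E × E*`. -/
def IsClosedGraph {E : Type*} [NormedAddCommGroup E] [NormedSpace ℝ E]
    (S : Multifunction E) : Prop := IsClosed S.graph

/-- `S` is quasidense if its graph is. -/
def IsQuasidense {E : Type*} [NormedAddCommGroup E] [NormedSpace ℝ E]
    (S : Multifunction E) : Prop := Quasidense S.graph

/-- `S` is monotone: `⟨x - y, x* - y*⟩ ≥ 0` for all `(x, x*), (y, y*) ∈ G(S)`. -/
def IsMonotone {E : Type*} [NormedAddCommGroup E] [NormedSpace ℝ E]
    (S : Multifunction E) : Prop :=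
  ∀ a ∈ S.graph, ∀ b ∈ S.graph, 0 ≤ qL (a - b)

/-- The Fitzpatrick function
`φ_S(x, x*) = sup {⟨s, x*⟩ + ⟨x, s*⟩ - ⟨s, s*⟩ | (s, s*) ∈ G(S)}`, with values in the extended
reals. -/
noncomputable def fitzpatrick {E : Type*} [NormedAddCommGroup E] [NormedSpace ℝ E]
    (S : Multifunction E) (b : E × StrongDual ℝ E) : EReal :=
  ⨆ s ∈ S.graph, ((b.2 s.1 + s.2 b.1 - qL s : ℝ) : EReal)

end Multifunction

/-! Write q for the pairing on E × E*. The work is in (c) ⇒ (d). Let h(x, w) be the infimum over u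
of φ_S(x, u) + φ_T(x, w - u). Quasidensity gives φ_S ≥ q and φ_T ≥ q, up to splitting w, so h is a
convex function above q. Condition (c) is what Fenchel duality needs for the constraint that φ_S and
φ_T share their first variable (`exists_multipliers`), and this duality is used twice. With the NI
property of S and T it shows that h - q + r_L(· - c) has infimum at most 0 for every c
(`exists_mem_sumEpi_lt`). Since h is convex and h ≥ q, iterated near-minimisers form a Cauchy
sequence, whose limit b is a limit of points where h - q is arbitrarily small, with r_L(b - c) small
(`exists_rL_lt_of_near`). At any such limit b, h lies above the tangent of q at b. A second use of
duality then splits b into a point of G(S) and a point of G(T) over the same x (`mem_graph_add`).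
Hence G(S + T) is exactly the set of these limits, which gives both closedness and quasidensity. -/

section ConvexDuality

/-! ### Open mapping for closed convex sets, and Lagrange multipliers -/

variable {W Y : Type*} [NormedAddCommGroup W] [NormedSpace ℝ W]
  [NormedAddCommGroup Y] [NormedSpace ℝ Y]

/-- The projection to `Y` of the part of `K` on which the first coordinate has norm at most `m`. -/
def boundedProj (K : Set (W × Y)) (m : ℝ) : Set Y := {y | ∃ w, (w, y) ∈ K ∧ ‖w‖ ≤ m}

omit [NormedSpace ℝ W] [NormedAddCommGroup Y] [NormedSpace ℝ Y] in
theorem boundedProj_mono (K : Set (W × Y)) {m n : ℝ} (h : m ≤ n) :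
    boundedProj K m ⊆ boundedProj K n :=
  fun _ ⟨w, hw, hm⟩ => ⟨w, hw, hm.trans h⟩

theorem convex_boundedProj {K : Set (W × Y)} (hK : Convex ℝ K) (m : ℝ) :
    Convex ℝ (boundedProj K m) := by
  rintro y ⟨w, hw, hm⟩ y' ⟨w', hw', hm'⟩ a b ha hb hab
  refine ⟨a • w + b • w', by simpa using hK hw hw' ha hb hab, ?_⟩
  calc ‖a • w + b • w'‖ ≤ ‖a • w‖ + ‖b • w'‖ := norm_add_le _ _
    _ = a * ‖w‖ + b * ‖w'‖ := by simp [norm_smul, abs_of_nonneg, ha, hb]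
    _ ≤ a * m + b * m := by gcongr
    _ = m := by rw [← add_mul, hab, one_mul]

theorem exists_smul_mem_boundedProj {K : Set (W × Y)} (hK : Convex ℝ K)
    (habs : ∀ y, ∃ c : ℝ, 0 < c ∧ ∃ w y', (w, y') ∈ K ∧ y = c • y') (y : Y) :
    ∃ N : ℝ, 0 < N ∧ ∀ n : ℝ, N ≤ n → n⁻¹ • y ∈ boundedProj K n := by
  obtain ⟨c, hc, w, y', hw, rfl⟩ := habs y
  -- A point of `K` over 0: convex combinations with it shrink the `Y`-coordinate freely, so one `N`
  -- serves every larger `n`.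
  obtain ⟨c₀, hc₀, w₀, y₀, hw₀, h0⟩ := habs 0
  obtain rfl : y₀ = 0 := by simpa [hc₀.ne'] using h0.symm
  refine ⟨c + ‖w‖ + ‖w₀‖, by positivity, fun n hn => ?_⟩
  have hn0 : 0 < n := lt_of_lt_of_le (by positivity) hn
  have hcn : n⁻¹ * c ≤ 1 := by
    rw [inv_mul_le_iff₀ hn0]; nlinarith [norm_nonneg w, norm_nonneg w₀]
  have h1 : 0 ≤ 1 - n⁻¹ * c := by linarith
  have h2 : 0 ≤ n⁻¹ * c := by positivity
  refine ⟨(n⁻¹ * c) • w + (1 - n⁻¹ * c) • w₀, ?_, ?_⟩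
  · have := hK hw hw₀ h2 h1 (by ring)
    simpa [smul_smul] using this
  · calc _ ≤ ‖(n⁻¹ * c) • w‖ + ‖(1 - n⁻¹ * c) • w₀‖ := norm_add_le _ _
      _ = (n⁻¹ * c) * ‖w‖ + (1 - n⁻¹ * c) * ‖w₀‖ := by
        rw [norm_smul, norm_smul, Real.norm_of_nonneg h1, Real.norm_of_nonneg h2]
      _ ≤ n := by nlinarith [norm_nonneg w, norm_nonneg w₀]

/-- Baire category gives one dilated closure with interior around some `y₀`. Averaging with a
multiple of `-y₀` moves the ball to the origin. -/
theorem exists_ball_subset_closure_boundedProj [CompleteSpace Y] {K : Set (W × Y)}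
    (hK : Convex ℝ K) (habs : ∀ y, ∃ c : ℝ, 0 < c ∧ ∃ w y', (w, y') ∈ K ∧ y = c • y') :
    ∃ m ρ : ℝ, 0 < ρ ∧ Metric.ball 0 ρ ⊆ closure (boundedProj K m) := by
  obtain ⟨n, y₀, hy₀⟩ := nonempty_interior_of_iUnion_of_closed
    (f := fun n : ℕ => (fun y : Y => ((n : ℝ) + 1)⁻¹ • y) ⁻¹' closure (boundedProj K ((n : ℝ) + 1)))
    (fun n => isClosed_closure.preimage (continuous_const_smul _)) (by
      refine Set.eq_univ_of_forall fun y => ?_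
      obtain ⟨N, -, hN⟩ := exists_smul_mem_boundedProj hK habs y
      obtain ⟨n, hn⟩ := exists_nat_ge N
      exact Set.mem_iUnion.2 ⟨n, subset_closure (hN _ (by linarith))⟩)
  obtain ⟨r, hr, hball⟩ := Metric.isOpen_iff.1 isOpen_interior y₀ hy₀
  obtain ⟨N, hN0, hN⟩ := exists_smul_mem_boundedProj hK habs (-y₀)
  set k : ℝ := (n : ℝ) + 1 with hk
  have hk0 : 0 < k := by positivity
  set m := max k N with hm
  have hm0 : 0 < m := lt_max_of_lt_left hk0
  refine ⟨m, r / (k + m), by positivity, fun z hz => ?_⟩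
  rw [mem_ball_zero_iff, lt_div_iff₀ (by positivity)] at hz
  have hy : k⁻¹ • (y₀ + (k + m) • z) ∈ closure (boundedProj K m) := by
    suffices hz' : y₀ + (k + m) • z ∈ Metric.ball y₀ r from
      closure_mono (boundedProj_mono K (le_max_left _ _))
        (Set.mem_preimage.1 (interior_subset (hball hz')))
    rw [Metric.mem_ball, dist_eq_norm, add_sub_cancel_left, norm_smul,
      Real.norm_of_nonneg (by positivity)]
    linarith
  have hy' : m⁻¹ • (-y₀) ∈ closure (boundedProj K m) := subset_closure (hN m (le_max_right _ _))
  have := (convex_boundedProj hK m).closure hy hy' (a := k / (k + m)) (b := m / (k + m))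
    (by positivity) (by positivity) (by field_simp)
  convert this using 1
  rw [smul_smul, smul_smul, smul_add, smul_smul, smul_neg]
  have e1 : k / (k + m) * k⁻¹ = (k + m)⁻¹ := by field_simp
  have e2 : m / (k + m) * m⁻¹ = (k + m)⁻¹ := by field_simp
  rw [e1, e2, inv_mul_cancel₀ (by positivity), one_smul]
  abel

/-- The successive approximation of the open mapping theorem removes the closure. The weights 1,
1/2, 1/4, ... add up to 2, so halving `y` turns the series into a convex one, which stays in the
closed convex set `K`. -/
theorem half_smul_mem_boundedProj [CompleteSpace W] {K : Set (W × Y)}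
    (hK : Convex ℝ K) (hKc : IsClosed K) {m ρ : ℝ} (hρ : 0 < ρ)
    (h : Metric.ball 0 ρ ⊆ closure (boundedProj K m)) {y : Y} (hy : ‖y‖ < ρ) :
    ((2 : ℝ)⁻¹ • y) ∈ boundedProj K m := by
  have step : ∀ z : Metric.ball (0 : Y) ρ, ∃ p : W × Y, p ∈ K ∧ ‖p.1‖ ≤ m ∧
      (2 : ℝ) • (z.1 - p.2) ∈ Metric.ball (0 : Y) ρ := by
    intro z
    obtain ⟨y', ⟨w, hw, hm⟩, hd⟩ := Metric.mem_closure_iff.1 (h z.2) (ρ / 2) (by positivity)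
    refine ⟨(w, y'), hw, hm, ?_⟩
    rw [mem_ball_zero_iff, norm_smul, ← dist_eq_norm]
    norm_num
    linarith
  choose p hpK hpm hpb using step
  let z : ℕ → Metric.ball (0 : Y) ρ := fun n =>
    Nat.rec ⟨y, by simpa using hy⟩ (fun _ u => ⟨(2 : ℝ) • (u.1 - (p u).2), hpb u⟩) n
  have hz0 : (z 0).1 = y := rfl
  have hzs : ∀ n, (z (n + 1)).1 = (2 : ℝ) • ((z n).1 - (p (z n)).2) := fun _ => rfl
  let c : ℕ → ℝ := fun n => (1 / 2 : ℝ) ^ (n + 1)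
  let s : ℕ → W × Y := fun n => ∑ i ∈ Finset.range n, c i • p (z i)
  -- The weights of `s n` fall short of 1 by (1/2)^n; any point of `K` may carry the missing mass.
  have hs : ∀ n, ∀ q ∈ K, s n + (1 / 2 : ℝ) ^ n • q ∈ K := by
    intro n
    induction n with
    | zero => intro q hq; simpa [s] using hq
    | succ n ih =>
      intro q hq
      have := ih _ (hK (hpK (z n)) hq (a := 1 / 2) (b := 1 / 2) (by norm_num) (by norm_num)
        (by norm_num))
      convert this using 1
      simp only [s, Finset.sum_range_succ, c, smul_add, smul_smul, pow_succ]
      abel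
  have hs2 : ∀ n, (s n).2 = (2 : ℝ)⁻¹ • y - (1 / 2 : ℝ) ^ (n + 1) • (z n).1 := by
    intro n
    induction n with
    | zero => simp [s, hz0]
    | succ n ih =>
      have : (s (n + 1)).2 = (s n).2 + (1 / 2 : ℝ) ^ (n + 1) • (p (z n)).2 := by
        simp [s, Finset.sum_range_succ, c]
      rw [this, ih, hzs, smul_smul, pow_succ (1 / 2 : ℝ) (n + 1)]
      simp only [smul_sub, mul_assoc]
      norm_num
      abel
  have hnorm : ∀ i, ‖c i • (p (z i)).1‖ ≤ c i * m := fun i => by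
    rw [norm_smul, Real.norm_of_nonneg (by positivity)]
    exact mul_le_mul_of_nonneg_left (hpm _) (by positivity)
  have hc : HasSum c 1 := by
    have := (hasSum_geometric_two).mul_left (1 / 2)
    rw [show (1 / 2 : ℝ) * 2 = 1 by norm_num] at this
    exact (funext fun i => pow_succ' (1 / 2 : ℝ) i : c = _) ▸ this
  have hsum : Summable fun i => c i • (p (z i)).1 :=
    Summable.of_norm_bounded (hc.summable.mul_right m) hnorm
  have ht0 : Filter.Tendsto (fun n => (1 / 2 : ℝ) ^ n) Filter.atTop (nhds 0) :=
    tendsto_pow_atTop_nhds_zero_of_lt_one (by norm_num) (by norm_num)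
  have ht1 : Filter.Tendsto (fun n => (s n).1) Filter.atTop
      (nhds (∑' i, c i • (p (z i)).1)) := by
    have := hsum.hasSum.tendsto_sum_nat
    convert this using 2 with n
    simp [s, Prod.fst_sum]
  have ht2 : Filter.Tendsto (fun n => (s n).2) Filter.atTop (nhds ((2 : ℝ)⁻¹ • y)) := by
    have : Filter.Tendsto (fun n => (1 / 2 : ℝ) ^ (n + 1) • (z n).1) Filter.atTop (nhds 0) := by
      refine squeeze_zero_norm (a := fun n => (1 / 2 : ℝ) ^ (n + 1) * ρ) (fun n => ?_) ?_
      · rw [norm_smul, Real.norm_of_nonneg (by positivity)]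
        exact mul_le_mul_of_nonneg_left (mem_ball_zero_iff.1 (z n).2).le (by positivity)
      · simpa using ((Filter.tendsto_add_atTop_iff_nat 1).2 ht0).mul_const ρ
    simpa [hs2] using this.const_sub ((2 : ℝ)⁻¹ • y)
  refine ⟨∑' i, c i • (p (z i)).1, ?_, ?_⟩
  · have hlim := (ht1.prodMk_nhds ht2).add (ht0.smul_const (p (z 0)))
    rw [zero_smul, add_zero] at hlim
    exact hKc.mem_of_tendsto hlim (Filter.Eventually.of_forall fun n => hs n _ (hpK _))
  · simpa using tsum_of_norm_bounded (hc.mul_right m) hnorm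

/-- Lagrange multipliers for the minimisation of a linear functional over the fibre above `0` of
a closed convex set, under an interior-point condition of Robinson type. -/
theorem exists_multiplier [CompleteSpace W] [CompleteSpace Y] {K : Set (W × Y)}
    (hK : Convex ℝ K) (hKc : IsClosed K)
    (habs : ∀ y, ∃ c : ℝ, 0 < c ∧ ∃ w y', (w, y') ∈ K ∧ y = c • y')
    (τ : W →L[ℝ] ℝ) (μ : ℝ) (hμ : ∀ w, (w, 0) ∈ K → μ ≤ τ w) :
    ∃ l : Y →L[ℝ] ℝ, ∀ w y, (w, y) ∈ K → μ + l y ≤ τ w := by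
  obtain ⟨m, ρ, hρ, hball⟩ := exists_ball_subset_closure_boundedProj hK habs
  -- The strict epigraph of the value function, the infimum of `τ` over the fibre above `y`. Fibre
  -- points of norm at most `m` bound this function near 0, so `U` has interior.
  let U : Set (Y × ℝ) := {p | ∃ w, (w, p.1) ∈ K ∧ τ w < p.2}
  have hU : Convex ℝ U := by
    rintro ⟨y, t⟩ ⟨w, hw, ht⟩ ⟨y', t'⟩ ⟨w', hw', ht'⟩ a b ha hb hab
    refine ⟨a • w + b • w', by simpa using hK hw hw' ha hb hab, ?_⟩
    simp only [map_add, map_smul, Prod.snd_add, Prod.smul_snd, smul_eq_mul]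
    dsimp only at ht ht'
    rcases ha.eq_or_lt with rfl | ha'
    · obtain rfl : b = 1 := by linarith
      linarith
    · nlinarith [mul_lt_mul_of_pos_left ht ha', mul_le_mul_of_nonneg_left ht'.le hb]
  have hsub : Metric.ball (0 : Y) (ρ / 2) ×ˢ Set.Ioi (‖τ‖ * m) ⊆ U := by
    rintro ⟨y, t⟩ ⟨hy, ht⟩
    obtain ⟨w, hw, hm⟩ := half_smul_mem_boundedProj hK hKc hρ hball (y := (2 : ℝ) • y) (by
      rw [norm_smul]; norm_num; rw [mem_ball_zero_iff] at hy; linarith)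
    refine ⟨w, by simpa [smul_smul] using hw, ?_⟩
    calc τ w ≤ ‖τ w‖ := le_abs_self _
      _ ≤ ‖τ‖ * ‖w‖ := τ.le_opNorm w
      _ ≤ ‖τ‖ * m := by gcongr
      _ < t := ht
  have hopen : IsOpen (Metric.ball (0 : Y) (ρ / 2) ×ˢ Set.Ioi (‖τ‖ * m)) :=
    Metric.isOpen_ball.prod isOpen_Ioi
  set T := max (‖τ‖ * m) μ + 1 with hT
  have hTmem : ((0 : Y), T) ∈ interior U := interior_maximal hsub hopen
    ⟨by simpa using hρ, by
      rw [Set.mem_Ioi]; exact lt_of_le_of_lt (le_max_left _ _) (lt_add_one _)⟩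
  have hTμ : μ < T := lt_of_le_of_lt (le_max_right _ _) (lt_add_one _)
  have hnot : ((0 : Y), μ) ∉ interior U := fun hmem => by
    obtain ⟨w, hw, hlt⟩ := interior_subset hmem
    exact absurd (hμ w hw) (not_le.2 hlt)
  obtain ⟨f, hf⟩ := geometric_hahn_banach_open_point hU.interior isOpen_interior hnot
  have hfle : ∀ p ∈ U, f p ≤ f (0, μ) := by
    intro p hp
    have hp' : p ∈ closure (interior U) := by
      rw [hU.closure_interior_eq_closure_of_nonempty_interior ⟨_, hTmem⟩]
      exact subset_closure hp
    exact closure_minimal (fun a ha => (hf a ha).le)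
      (isClosed_le f.continuous continuous_const) hp'
  have hdec : ∀ (y : Y) (t : ℝ), f (y, t) = f (y, 0) + t * f (0, 1) := fun y t => by
    have : ((y, t) : Y × ℝ) = (y, 0) + t • (0, 1) := by simp
    rw [this, map_add, map_smul, smul_eq_mul]
  -- The separating hyperplane is not vertical, because an interior point of `U` lies directly above
  -- `(0, μ)`.
  have hs : f (0, 1) < 0 := by
    have := hf _ hTmem
    rw [hdec 0 T, hdec 0 μ] at this
    nlinarith
  set σ := -f (0, 1) with hσ
  have hσ0 : 0 < σ := by linarith
  refine ⟨σ⁻¹ • f.comp (ContinuousLinearMap.inl ℝ Y ℝ), fun w y hw => ?_⟩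
  refine le_of_forall_pos_le_add fun ε hε => ?_
  have := hfle (y, τ w + ε) ⟨w, hw, by dsimp only; linarith⟩
  rw [hdec y, hdec 0 μ, show f ((0 : Y), (0 : ℝ)) = 0 from map_zero f] at this
  have h2 : f (y, 0) ≤ σ * (τ w + ε - μ) := by rw [hσ]; linarith
  have h3 : σ⁻¹ * f (y, 0) ≤ τ w + ε - μ := by rwa [inv_mul_le_iff₀ hσ0]
  simp only [smul_apply, ContinuousLinearMap.comp_apply,
    ContinuousLinearMap.inl_apply, smul_eq_mul]
  linarith

end ConvexDuality

/-! ### The forms q and r_L -/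

section QuadraticForm

variable {E : Type*} [NormedAddCommGroup E] [NormedSpace ℝ E]

theorem qL_add (a b : E × StrongDual ℝ E) :
    qL (a + b) = qL a + qL b + (a.2 b.1 + b.2 a.1) := by
  simp only [qL, Prod.snd_add, Prod.fst_add, map_add, add_apply]; ring

theorem qL_sub (a b : E × StrongDual ℝ E) :
    qL (a - b) = qL a + qL b - (a.2 b.1 + b.2 a.1) := by
  simp only [qL, Prod.snd_sub, Prod.fst_sub, map_sub, sub_apply]; ring

theorem qL_smul (t : ℝ) (a : E × StrongDual ℝ E) : qL (t • a) = t ^ 2 * qL a := by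
  simp only [qL, Prod.smul_fst, Prod.smul_snd, map_smul, smul_apply, smul_eq_mul]; ring

theorem continuous_qL : Continuous (qL : E × StrongDual ℝ E → ℝ) := by
  unfold qL; fun_prop

theorem continuous_rL : Continuous (rL : E × StrongDual ℝ E → ℝ) := by
  unfold rL
  have := continuous_qL (E := E)
  fun_prop

theorem abs_pairing_le (a b : E × StrongDual ℝ E) : |a.2 b.1| ≤ ‖a‖ * ‖b‖ :=
  (a.2.le_opNorm b.1).trans
    (mul_le_mul (norm_snd_le a) (norm_fst_le b) (norm_nonneg _) (norm_nonneg _))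

theorem half_norm_sq_add_qL_le_rL (a : E × StrongDual ℝ E) :
    1 / 2 * ‖a‖ ^ 2 + qL a ≤ rL a := by
  unfold rL
  rw [Prod.norm_def]
  rcases max_choice ‖a.1‖ ‖a.2‖ with h | h <;> rw [h] <;>
    nlinarith [sq_nonneg ‖a.1‖, sq_nonneg ‖a.2‖]

theorem rL_nonneg (a : E × StrongDual ℝ E) : 0 ≤ rL a := by
  have h := abs_le.1 (a.2.le_opNorm a.1 : |a.2 a.1| ≤ _)
  unfold rL qL
  nlinarith [sq_nonneg (‖a.1‖ - ‖a.2‖)]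

theorem rL_add_le (a d : E × StrongDual ℝ E) :
    rL (a + d) ≤ rL a + (4 * ‖a‖ * ‖d‖ + 2 * ‖d‖ ^ 2) := by
  have h0 := qL_add a d
  have h1 := (abs_le.1 (abs_pairing_le a d)).2
  have h2 := (abs_le.1 (abs_pairing_le d a)).2
  have h3 := (abs_le.1 (abs_pairing_le d d)).2
  have key : ∀ x y : ℝ, 0 ≤ x → 0 ≤ y → x ≤ ‖a‖ → y ≤ ‖d‖ →
      (x + y) ^ 2 ≤ x ^ 2 + (2 * ‖a‖ * ‖d‖ + ‖d‖ ^ 2) := fun x y hx hy hxa hyd => by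
    nlinarith [mul_le_mul hxa hyd hy (norm_nonneg a), mul_le_mul hyd hyd hy (norm_nonneg d)]
  have h4 := (pow_le_pow_left₀ (norm_nonneg _) (norm_add_le a.1 d.1) 2).trans
    (key _ _ (norm_nonneg _) (norm_nonneg _) (norm_fst_le a) (norm_fst_le d))
  have h5 := (pow_le_pow_left₀ (norm_nonneg _) (norm_add_le a.2 d.2) 2).trans
    (key _ _ (norm_nonneg _) (norm_nonneg _) (norm_snd_le a) (norm_snd_le d))
  have h6 : qL d = d.2 d.1 := rfl
  unfold rL
  rw [Prod.fst_add, Prod.snd_add]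
  nlinarith

/-- For a functional `f`, `-½‖f‖²` is approximated by values of `½‖x‖² + f x`. -/
theorem exists_half_norm_sq_add_lt {V : Type*} [NormedAddCommGroup V] [NormedSpace ℝ V]
    (f : StrongDual ℝ V) {ε : ℝ} (hε : 0 < ε) :
    ∃ x, 1 / 2 * ‖x‖ ^ 2 + f x < -(1 / 2) * ‖f‖ ^ 2 + ε := by
  set n := ‖f‖
  have hn : 0 ≤ n := norm_nonneg f
  have hlt : n * (ε / (n + 1)) < ε := by
    rw [mul_div_assoc', div_lt_iff₀ (by positivity)]; linarith
  obtain ⟨x, hx, hfx⟩ := f.exists_lt_apply_of_lt_opNorm (r := n - ε / (n + 1))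
    (sub_lt_self _ (by positivity))
  obtain ⟨x', hx', hfx'⟩ : ∃ x', ‖x'‖ < 1 ∧ f x' = -‖f x‖ := by
    rcases le_total (f x) 0 with h | h
    · exact ⟨x, hx, by rw [Real.norm_of_nonpos h, neg_neg]⟩
    · exact ⟨-x, by rwa [norm_neg], by rw [Real.norm_of_nonneg h, map_neg]⟩
  refine ⟨n • x', ?_⟩
  rw [norm_smul, Real.norm_of_nonneg hn, map_smul, hfx', smul_eq_mul]
  have h1 : (n * ‖x'‖) ^ 2 ≤ n ^ 2 :=
    pow_le_pow_left₀ (by positivity) (by nlinarith [norm_nonneg x']) 2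
  nlinarith [mul_le_mul_of_nonneg_left hfx.le hn]

end QuadraticForm

/-! ### Quasidense sets: maximality and type NI -/

section QuasidenseSets

variable {E : Type*} [NormedAddCommGroup E] [NormedSpace ℝ E]

theorem Quasidense.exists_rL_lt {A : Set (E × StrongDual ℝ E)} (hA : Quasidense A)
    (c : E × StrongDual ℝ E) {ε : ℝ} (hε : 0 < ε) : ∃ a ∈ A, rL (a - c) < ε := by
  by_contra! h
  have h1 : (ε : EReal) ≤ ⨅ a ∈ A, ((rL (a - c) : ℝ) : EReal) :=
    le_iInf₂ fun a ha => EReal.coe_le_coe_iff.2 (h a ha)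
  exact absurd (EReal.coe_le_coe_iff.1 (h1.trans (hA c))) (not_le.2 hε)

theorem quasidense_of_forall_exists {A : Set (E × StrongDual ℝ E)}
    (h : ∀ c, ∀ ε > 0, ∃ a ∈ A, rL (a - c) ≤ ε) : Quasidense A := by
  intro c
  refine EReal.le_of_forall_lt_iff_le.1 fun ε hε => ?_
  obtain ⟨a, ha, hle⟩ := h c ε (by exact_mod_cast hε)
  exact (iInf₂_le a ha).trans (EReal.coe_le_coe_iff.2 hle)

theorem Quasidense.exists_qL_lt {A : Set (E × StrongDual ℝ E)} (hA : Quasidense A)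
    (c : E × StrongDual ℝ E) {ε : ℝ} (hε : 0 < ε) : ∃ a ∈ A, qL (a - c) < ε := by
  obtain ⟨a, ha, hlt⟩ := hA.exists_rL_lt c hε
  exact ⟨a, ha, by nlinarith [half_norm_sq_add_qL_le_rL (a - c), sq_nonneg ‖a - c‖]⟩

/-- A closed quasidense set contains every point that is monotonically related to it. -/
theorem Quasidense.mem_of_forall_qL_nonneg {A : Set (E × StrongDual ℝ E)} (hA : Quasidense A)
    (hAc : IsClosed A) {b : E × StrongDual ℝ E} (hb : ∀ a ∈ A, 0 ≤ qL (a - b)) : b ∈ A := by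
  rw [← hAc.closure_eq, Metric.mem_closure_iff]
  intro ε hε
  obtain ⟨a, ha, hlt⟩ := hA.exists_rL_lt b (ε := ε ^ 2 / 2) (by positivity)
  refine ⟨a, ha, ?_⟩
  rw [dist_comm, dist_eq_norm]
  refine lt_of_pow_lt_pow_left₀ 2 hε.le ?_
  nlinarith [half_norm_sq_add_qL_le_rL (a - b), hb a ha]

/-- Quasidense sets are of negative-infimum type (NI). -/
theorem Quasidense.exists_qL_sub_lt {A : Set (E × StrongDual ℝ E)} (hA : Quasidense A)
    (z : StrongDual ℝ E) (y : StrongDual ℝ (StrongDual ℝ E)) {ε : ℝ} (hε : 0 < ε) :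
    ∃ a ∈ A, qL a - z a.1 - y a.2 < -y z + ε := by
  -- Shifting the test point by a near-minimiser `v` of ½‖v‖² + y v lets the bidual functional `y`
  -- be handled with test points in E × E*; two Young inequalities finish.
  obtain ⟨v, hv⟩ := exists_half_norm_sq_add_lt y (half_pos hε)
  obtain ⟨a, ha, hlt⟩ := hA.exists_rL_lt (0, z - v) (half_pos hε)
  refine ⟨a, ha, ?_⟩
  have h1 := abs_le.1 (v.le_opNorm a.1 : |v a.1| ≤ _)
  have h2 := abs_le.1 (y.le_opNorm (a.2 - (z - v)) : |_| ≤ _)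
  simp only [rL, qL, Prod.fst_sub, Prod.snd_sub, sub_zero, sub_apply] at hlt
  simp only [map_sub] at h2
  unfold qL
  nlinarith [sq_nonneg (‖v‖ - ‖a.1‖), sq_nonneg (‖y‖ - ‖a.2 - (z - v)‖)]

end QuasidenseSets

/-! ### Fitzpatrick functions and the duality theorem -/

namespace Multifunction

variable {E : Type*} [NormedAddCommGroup E] [NormedSpace ℝ E]

/-- The epigraph of the Fitzpatrick function. -/
def fitzEpi (S : Multifunction E) : Set ((E × StrongDual ℝ E) × ℝ) :=
  {p | ∀ s ∈ S.graph, p.1.2 s.1 + s.2 p.1.1 - qL s ≤ p.2}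

theorem isClosed_fitzEpi (S : Multifunction E) : IsClosed S.fitzEpi := by
  simp only [fitzEpi, Set.ofPred_forall]
  exact isClosed_biInter fun s _ => isClosed_le (by fun_prop) (by fun_prop)

theorem convex_fitzEpi (S : Multifunction E) : Convex ℝ S.fitzEpi := by
  intro p hp p' hp' α β hα hβ hαβ s hs
  have h1 := mul_le_mul_of_nonneg_left (hp s hs) hα
  have h2 := mul_le_mul_of_nonneg_left (hp' s hs) hβ
  simp only [Prod.fst_add, Prod.smul_fst, Prod.snd_add, Prod.smul_snd, map_add, map_smul,
    add_apply, smul_apply, smul_eq_mul]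
  linear_combination h1 + h2 + qL s * hαβ

theorem IsMonotone.mem_fitzEpi {S : Multifunction E} (hS : S.IsMonotone)
    {a : E × StrongDual ℝ E} (ha : a ∈ S.graph) : (a, qL a) ∈ S.fitzEpi := by
  intro s hs
  have h := hS a ha s hs
  rw [qL_sub] at h
  dsimp only
  linarith

/-- The defining inequality says q(b) - q(a - b) ≤ t for `a` in the graph, and quasidensity makes
q(a - b) smaller than any positive number. -/
theorem IsQuasidense.qL_le {S : Multifunction E} (hS : S.IsQuasidense)
    {b : E × StrongDual ℝ E} {t : ℝ} (h : (b, t) ∈ S.fitzEpi) : qL b ≤ t := by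
  refine le_of_forall_pos_le_add fun ε hε => ?_
  obtain ⟨a, ha, hlt⟩ := Quasidense.exists_qL_lt hS b hε
  have h1 := h a ha
  rw [qL_sub] at hlt
  dsimp only at h1
  linarith

theorem IsQuasidense.graph_nonempty {S : Multifunction E} (hS : S.IsQuasidense) :
    S.graph.Nonempty :=
  let ⟨a, ha, _⟩ := Quasidense.exists_rL_lt hS 0 one_pos
  ⟨a, ha⟩

/-- The projection to `E` of the effective domain of the Fitzpatrick function. -/
def fitzDom (S : Multifunction E) : Set E := {x | ∃ u t, ((x, u), t) ∈ S.fitzEpi}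

theorem fst_image_effDom_fitzpatrick {S : Multifunction E} (hS : S.graph.Nonempty) :
    Prod.fst '' effDom S.fitzpatrick = S.fitzDom := by
  ext x
  constructor
  · rintro ⟨⟨x, u⟩, ⟨r, hr⟩, rfl⟩
    refine ⟨u, r, fun s hs => EReal.coe_le_coe_iff.1 ?_⟩
    rw [← hr]
    exact le_iSup₂ (f := fun s (_ : s ∈ S.graph) => ((u s.1 + s.2 x - qL s : ℝ) : EReal)) s hs
  · rintro ⟨u, t, h⟩
    obtain ⟨s, hs⟩ := hS
    have hle : S.fitzpatrick (x, u) ≤ (t : EReal) :=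
      iSup₂_le fun s hs => EReal.coe_le_coe_iff.2 (h s hs)
    have hge : ((u s.1 + s.2 x - qL s : ℝ) : EReal) ≤ S.fitzpatrick (x, u) :=
      le_iSup₂ (f := fun s (_ : s ∈ S.graph) => ((u s.1 + s.2 x - qL s : ℝ) : EReal)) s hs
    refine ⟨(x, u), ⟨(S.fitzpatrick (x, u)).toReal, (EReal.coe_toReal ?_ ?_).symm⟩, rfl⟩
    · exact ne_top_of_le_ne_top (EReal.coe_ne_top t) hle
    · exact ne_bot_of_le_ne_bot (EReal.coe_ne_bot _) hge

theorem IsMonotone.domain_subset_fitzDom {S : Multifunction E} (hS : S.IsMonotone) :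
    S.domain ⊆ S.fitzDom :=
  fun x ⟨u, hu⟩ => ⟨u, _, hS.mem_fitzEpi (a := (x, u)) hu⟩

/-- Fenchel duality for the minimisation of `φ_S(x, u) + φ_T(x, v) + g(x, u + v)`, with multipliers
tested on the graphs of `S` and `T`. -/
theorem exists_multipliers [CompleteSpace E] {S T : Multifunction E}
    (hSm : S.IsMonotone) (hTm : T.IsMonotone) (F : Submodule ℝ E) (hFc : IsClosed (F : Set E))
    (hF : (⋃ (c : ℝ) (_ : 0 < c), c • (S.fitzDom - T.fitzDom)) = (F : Set E))
    {g : E × StrongDual ℝ E → ℝ} (hg : ConvexOn ℝ Set.univ g) (hgc : Continuous g) (μ : ℝ)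
    (hμ : ∀ x u v s t, ((x, u), s) ∈ S.fitzEpi → ((x, v), t) ∈ T.fitzEpi →
      μ ≤ s + t + g (x, u + v)) :
    ∃ (z y : StrongDual ℝ E) (y' : StrongDual ℝ (StrongDual ℝ E)),
      ∀ a ∈ S.graph, ∀ a' ∈ T.graph, ∀ b,
        μ + z (a.1 - a'.1) + y (a'.1 - b.1) + y' (a.2 + a'.2 - b.2) ≤ qL a + qL a' + g b := by
  have : CompleteSpace F := hFc.completeSpace_coe
  -- The perturbation has three components: the mismatch of the two first variables, kept in `F`,
  -- and a shift of each argument of `g`. The fibre over 0 is the original problem.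
  let K : Set ((((E × StrongDual ℝ E) × ℝ) × ((E × StrongDual ℝ E) × ℝ) × ℝ) × (F × (E × StrongDual ℝ E))) :=
    {p | p.1.1 ∈ S.fitzEpi ∧ p.1.2.1 ∈ T.fitzEpi ∧
      g (p.1.2.1.1.1 - p.2.2.1, p.1.1.1.2 + p.1.2.1.1.2 - p.2.2.2) ≤ p.1.2.2 ∧
      (p.2.1 : E) = p.1.1.1.1 - p.1.2.1.1.1}
  have hKconv : Convex ℝ K := by
    rintro p ⟨h1, h2, h3, h4⟩ p' ⟨h1', h2', h3', h4'⟩ α β hα hβ hαβ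
    refine ⟨S.convex_fitzEpi h1 h1' hα hβ hαβ, T.convex_fitzEpi h2 h2' hα hβ hαβ, ?_, ?_⟩
    · have h := hg.2 (Set.mem_univ (p.1.2.1.1.1 - p.2.2.1, p.1.1.1.2 + p.1.2.1.1.2 - p.2.2.2))
        (Set.mem_univ (p'.1.2.1.1.1 - p'.2.2.1, p'.1.1.1.2 + p'.1.2.1.1.2 - p'.2.2.2)) hα hβ hαβ
      have h5 := mul_le_mul_of_nonneg_left h3 hα
      have h6 := mul_le_mul_of_nonneg_left h3' hβ
      simp only [smul_eq_mul] at h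
      refine le_trans (le_of_eq ?_) (h.trans (add_le_add h5 h6))
      congr 1
      ext1
      · simp only [Prod.fst_add, Prod.smul_fst, Prod.snd_add, Prod.smul_snd, smul_sub]; abel
      · simp only [Prod.fst_add, Prod.smul_fst, Prod.snd_add, Prod.smul_snd, smul_sub, smul_add]
        abel
    · simp only [Prod.fst_add, Prod.smul_fst, Prod.snd_add, Prod.smul_snd, Submodule.coe_add,
        Submodule.coe_smul, h4, h4', smul_sub]
      abel
  have hKc : IsClosed K := by
    refine IsClosed.and (S.isClosed_fitzEpi.preimage (by fun_prop)) (IsClosed.and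
      (T.isClosed_fitzEpi.preimage (by fun_prop)) (IsClosed.and ?_ ?_))
    · exact isClosed_le (by fun_prop) (by fun_prop)
    · exact isClosed_eq (by fun_prop) (by fun_prop)
  have habs : ∀ y : F × (E × StrongDual ℝ E), ∃ c : ℝ, 0 < c ∧ ∃ w y', (w, y') ∈ K ∧ y = c • y' := by
    rintro ⟨f, e⟩
    have hf : (f : E) ∈ ⋃ (c : ℝ) (_ : 0 < c), c • (S.fitzDom - T.fitzDom) := hF ▸ f.2
    simp only [Set.mem_iUnion] at hf
    obtain ⟨c, hc, -, ⟨x, ⟨u, s, hs⟩, x', ⟨v, t, ht⟩, rfl⟩, hfx⟩ := hf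
    -- Only the `F`-component needs the hypothesis on the domains; the other two are free because
    -- `g` is finite everywhere.
    refine ⟨c, hc, (((x, u), s), ((x', v), t), g (x' - (c⁻¹ • e).1, u + v - (c⁻¹ • e).2)),
      c⁻¹ • (f, e), ⟨hs, ht, le_rfl, ?_⟩, (smul_inv_smul₀ hc.ne' _).symm⟩
    simp only [Prod.smul_fst, Submodule.coe_smul, ← hfx]
    exact inv_smul_smul₀ hc.ne' _
  let τ : (((E × StrongDual ℝ E) × ℝ) × ((E × StrongDual ℝ E) × ℝ) × ℝ) →L[ℝ] ℝ :=
    (ContinuousLinearMap.snd ℝ (E × StrongDual ℝ E) ℝ).coprod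
      ((ContinuousLinearMap.snd ℝ (E × StrongDual ℝ E) ℝ).coprod (ContinuousLinearMap.id ℝ ℝ))
  have hτ : ∀ w, τ w = w.1.2 + (w.2.1.2 + w.2.2) := fun w => by simp [τ]
  obtain ⟨l, hl⟩ := exists_multiplier hKconv hKc habs τ μ (by
    rintro ⟨⟨⟨x, u⟩, s⟩, ⟨⟨x', v⟩, t⟩, r⟩ ⟨h1, h2, h3, h4⟩
    have hx : x = x' := by simpa [sub_eq_zero, eq_comm] using h4
    subst hx
    have h5 := hμ _ _ _ _ _ h1 h2
    simp only [Prod.fst_zero, Prod.snd_zero, sub_zero] at h3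
    rw [hτ]
    dsimp only
    linarith)
  -- The multiplier lives on `F` only; Hahn–Banach extends it to E.
  obtain ⟨z, hz, -⟩ := exists_extension_norm_eq F (l.comp (ContinuousLinearMap.inl ℝ F (E × StrongDual ℝ E)))
  refine ⟨z, l.comp ((ContinuousLinearMap.inr ℝ F (E × StrongDual ℝ E)).comp (ContinuousLinearMap.inl ℝ _ _)),
    l.comp ((ContinuousLinearMap.inr ℝ F (E × StrongDual ℝ E)).comp (ContinuousLinearMap.inr ℝ _ _)), ?_⟩
  intro a ha a' ha' b
  have hmem : a.1 - a'.1 ∈ F := by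
    rw [← SetLike.mem_coe, ← hF]
    simp only [Set.mem_iUnion]
    refine ⟨1, one_pos, ?_⟩
    rw [one_smul]
    exact Set.sub_mem_sub ⟨a.2, _, hSm.mem_fitzEpi ha⟩ ⟨a'.2, _, hTm.mem_fitzEpi ha'⟩
  have h := hl ((a, qL a), (a', qL a'), g b) (⟨a.1 - a'.1, hmem⟩, (a'.1 - b.1, a.2 + a'.2 - b.2))
    ⟨hSm.mem_fitzEpi ha, hTm.mem_fitzEpi ha', by simp, rfl⟩
  have hsplit : ((⟨a.1 - a'.1, hmem⟩, (a'.1 - b.1, a.2 + a'.2 - b.2)) : F × (E × StrongDual ℝ E)) =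
      ContinuousLinearMap.inl ℝ F (E × StrongDual ℝ E) ⟨a.1 - a'.1, hmem⟩ +
      ContinuousLinearMap.inr ℝ F (E × StrongDual ℝ E) (ContinuousLinearMap.inl ℝ _ _ (a'.1 - b.1)) +
      ContinuousLinearMap.inr ℝ F (E × StrongDual ℝ E) (ContinuousLinearMap.inr ℝ _ _ (a.2 + a'.2 - b.2)) := by
    simp
  rw [hsplit, map_add, map_add, hτ] at h
  have hz' := hz ⟨a.1 - a'.1, hmem⟩
  dsimp only at h hz'
  rw [hz']
  simp only [ContinuousLinearMap.comp_apply]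
  linarith

end Multifunction

/-! ### Convex functions above q, and the points where they nearly meet it -/

section NearCoincidence

variable {E : Type*} [NormedAddCommGroup E] [NormedSpace ℝ E]

/-- The points at which the convex function with epigraph generated by `H` exceeds `qL` by at most
`δ`. -/
def nearCoincidence (H : Set ((E × StrongDual ℝ E) × ℝ)) (δ : ℝ) : Set (E × StrongDual ℝ E) :=
  {b | ∃ r, (b, r) ∈ H ∧ r ≤ qL b + δ}

/-- Convexity at the midpoint, combined with the parallelogram law for q. This bounds below an
otherwise indefinite form, and thereby makes the later distance estimates possible. -/
theorem neg_qL_sub_le {H : Set ((E × StrongDual ℝ E) × ℝ)} (hH : Convex ℝ H)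
    (hq : ∀ p ∈ H, qL p.1 ≤ p.2) {p p' : (E × StrongDual ℝ E) × ℝ} (hp : p ∈ H) (hp' : p' ∈ H) :
    -qL (p.1 - p'.1) ≤ 2 * ((p.2 - qL p.1) + (p'.2 - qL p'.1)) := by
  have h := hq _ (hH hp hp' (a := 1 / 2) (b := 1 / 2) (by norm_num) (by norm_num) (by norm_num))
  simp only [Prod.fst_add, Prod.smul_fst, Prod.snd_add, Prod.smul_snd, smul_eq_mul, qL_add,
    qL_smul, map_smul, smul_apply] at h
  rw [qL_sub]
  linarith

/-- First-order condition: move from `b` towards `p` by a fraction `t`, divide by `t` and let `t`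
tend to 0. The tolerance is taken as t², so that it disappears in the limit. -/
theorem pairing_sub_qL_le {H : Set ((E × StrongDual ℝ E) × ℝ)} (hH : Convex ℝ H)
    (hq : ∀ p ∈ H, qL p.1 ≤ p.2) {b : E × StrongDual ℝ E}
    (hb : ∀ δ > 0, b ∈ closure (nearCoincidence H δ)) {p : (E × StrongDual ℝ E) × ℝ}
    (hp : p ∈ H) : p.1.2 b.1 + b.2 p.1.1 - qL b ≤ p.2 := by
  have key : ∀ t : ℝ, 0 < t → t < 1 →
      (1 - t) ^ 2 * qL b + t * (1 - t) * (p.1.2 b.1 + b.2 p.1.1) + t ^ 2 * qL p.1 ≤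
        (1 - t) * (qL b + t ^ 2) + t * p.2 := by
    intro t ht ht1
    have hcl : IsClosed {b : E × StrongDual ℝ E |
        (1 - t) ^ 2 * qL b + t * (1 - t) * (p.1.2 b.1 + b.2 p.1.1) + t ^ 2 * qL p.1 ≤
          (1 - t) * (qL b + t ^ 2) + t * p.2} := by
      have := continuous_qL (E := E)
      exact isClosed_le (by fun_prop) (by fun_prop)
    refine closure_minimal ?_ hcl (hb (t ^ 2) (by positivity))
    rintro b ⟨r, hr, hle⟩
    have h := hq _ (hH hr hp (sub_nonneg.2 ht1.le) ht.le (by ring))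
    simp only [Prod.fst_add, Prod.smul_fst, Prod.snd_add, Prod.smul_snd, smul_eq_mul, qL_add,
      qL_smul, map_smul, smul_apply] at h
    have h2 := mul_le_mul_of_nonneg_left hle (sub_nonneg.2 ht1.le)
    rw [Set.mem_ofPred_eq]
    linarith
  set X := p.1.2 b.1 + b.2 p.1.1
  set Q := qL b - X + qL p.1
  refine le_of_forall_pos_le_add fun ε hε => ?_
  set t := min (1 / 2) (ε / (1 + |Q|))
  have ht : 0 < t := lt_min (by norm_num) (by positivity)
  have ht1 : t ≤ 1 / 2 := min_le_left _ _
  have ht2 : t * (1 + |Q|) ≤ ε := by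
    rw [← le_div_iff₀ (by positivity)]; exact min_le_right _ _
  have h := key t ht (by linarith)
  have h1 : t * (X - qL b - p.2) ≤ t * (t * (1 - Q)) := by
    simp only [Q]
    nlinarith [pow_pos ht 3]
  have h2 := le_of_mul_le_mul_left h1 ht
  nlinarith [neg_abs_le Q]

/-- Along such points -q(p - c) grows at most linearly in ‖p - c‖, while ½‖p - c‖² ≤ r_L(p - c) -
q(p - c). -/
theorem exists_norm_sub_le {H : Set ((E × StrongDual ℝ E) × ℝ)} (hH : Convex ℝ H)
    (hq : ∀ p ∈ H, qL p.1 ≤ p.2) (hne : ∃ p ∈ H, p.2 - qL p.1 ≤ 1) (c : E × StrongDual ℝ E) :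
    ∃ R : ℝ, 0 ≤ R ∧ ∀ p ∈ H, p.2 - qL p.1 ≤ 1 → rL (p.1 - c) ≤ 1 → ‖p.1 - c‖ ≤ R := by
  obtain ⟨p₀, hp₀, h₀⟩ := hne
  set k := ‖p₀.1 - c‖ with hk
  have hk0 : 0 ≤ k := norm_nonneg _
  refine ⟨10 + 10 * k, by positivity, fun p hp h1 h2 => ?_⟩
  set n := ‖p.1 - c‖ with hn
  have hn0 : 0 ≤ n := norm_nonneg _
  have h3 := neg_qL_sub_le hH hq hp hp₀
  have h4 := half_norm_sq_add_qL_le_rL (p.1 - c)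
  have h5 := qL_sub (p.1 - c) (p₀.1 - c)
  rw [sub_sub_sub_cancel_right] at h5
  have h6 := (abs_le.1 (abs_pairing_le (p.1 - c) (p₀.1 - c))).1
  have h7 := (abs_le.1 (abs_pairing_le (p₀.1 - c) (p.1 - c))).1
  have h8 := (abs_le.1 (abs_pairing_le (p₀.1 - c) (p₀.1 - c))).2
  have h9 : qL (p₀.1 - c) = (p₀.1 - c).2 (p₀.1 - c).1 := rfl
  rw [← hn] at h4
  rw [← hn, ← hk] at h6 h7
  rw [← hk] at h8
  by_contra! hlt
  nlinarith

/-- Each new point is a near-minimiser recentred at the previous one, with tolerance (η/2^n)². The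
gaps and `neg_qL_sub_le` bound consecutive distances by 4η/2^n, which add up to 8η. -/
theorem exists_near_limit [CompleteSpace E] {H : Set ((E × StrongDual ℝ E) × ℝ)}
    (hH : Convex ℝ H) (hq : ∀ p ∈ H, qL p.1 ≤ p.2)
    (hN : ∀ c, ∀ ε > 0, ∃ p ∈ H, p.2 - qL p.1 + rL (p.1 - c) < ε)
    (c : E × StrongDual ℝ E) {η : ℝ} (hη : 0 < η) :
    ∃ p ∈ H, p.2 - qL p.1 + rL (p.1 - c) < η ^ 2 ∧
      ∃ b, ‖b - p.1‖ ≤ 8 * η ∧ ∀ δ > 0, b ∈ closure (nearCoincidence H δ) := by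
  choose f hfH hf using fun (c : E × StrongDual ℝ E) (n : ℕ) =>
    hN c ((η / 2 ^ n) ^ 2) (by positivity)
  let p : ℕ → (E × StrongDual ℝ E) × ℝ := fun n => Nat.rec (f c 0) (fun n q => f q.1 (n + 1)) n
  have hpH : ∀ n, p n ∈ H := fun n => by cases n <;> exact hfH _ _
  have hps : ∀ n, (p (n + 1)).2 - qL (p (n + 1)).1 + rL ((p (n + 1)).1 - (p n).1) <
      (η / 2 ^ (n + 1)) ^ 2 := fun n => hf _ _
  have hp0 : (p 0).2 - qL (p 0).1 + rL ((p 0).1 - c) < η ^ 2 := by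
    have h := hf c 0
    rwa [pow_zero, div_one] at h
  have hgap : ∀ n, (p n).2 - qL (p n).1 ≤ (η / 2 ^ n) ^ 2 := fun n => by
    cases n with
    | zero => simpa using (le_add_of_nonneg_right (rL_nonneg _)).trans hp0.le
    | succ n => exact (le_add_of_nonneg_right (rL_nonneg _)).trans (hps n).le
  have hdist : ∀ n, dist (p n).1 (p (n + 1)).1 ≤ 8 * η / 2 / 2 ^ n := by
    intro n
    rw [dist_comm, dist_eq_norm]
    refine le_of_sq_le_sq ?_ (by positivity)
    have e1 : (η / 2 ^ (n + 1)) ^ 2 = 1 / 4 * (η / 2 ^ n) ^ 2 := by rw [pow_succ]; ring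
    have e2 : (8 * η / 2 / 2 ^ n) ^ 2 = 16 * (η / 2 ^ n) ^ 2 := by ring
    have h1 := hps n
    have h2 := neg_qL_sub_le hH hq (hpH (n + 1)) (hpH n)
    have h3 := half_norm_sq_add_qL_le_rL ((p (n + 1)).1 - (p n).1)
    have h4 := hgap n
    have h5 := hgap (n + 1)
    have h6 := hq _ (hpH (n + 1))
    rw [e1] at h1 h5
    rw [e2]
    nlinarith [sq_nonneg (η / 2 ^ n)]
  obtain ⟨b, hb⟩ := cauchySeq_tendsto_of_complete (cauchySeq_of_le_geometric_two hdist)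
  refine ⟨p 0, hpH 0, hp0, b, ?_, fun δ hδ => ?_⟩
  · rw [← dist_eq_norm, dist_comm]
    exact dist_le_of_le_geometric_two_of_tendsto₀ hdist hb
  · have hlim : Filter.Tendsto (fun n : ℕ => (η / 2 ^ n) ^ 2) Filter.atTop (nhds 0) := by
      have := ((tendsto_pow_atTop_nhds_zero_of_lt_one (r := (1 / 2 : ℝ)) (by norm_num)
        (by norm_num)).const_mul η).pow 2
      simpa [div_eq_mul_inv] using this
    refine mem_closure_of_tendsto hb ((hlim.eventually_lt_const hδ).mono fun n hn => ?_)
    exact ⟨(p n).2, hpH n, by linarith [hgap n]⟩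

theorem exists_rL_lt_of_near [CompleteSpace E] {H : Set ((E × StrongDual ℝ E) × ℝ)}
    (hH : Convex ℝ H) (hq : ∀ p ∈ H, qL p.1 ≤ p.2)
    (hN : ∀ c, ∀ ε > 0, ∃ p ∈ H, p.2 - qL p.1 + rL (p.1 - c) < ε)
    (c : E × StrongDual ℝ E) {ε : ℝ} (hε : 0 < ε) :
    ∃ b, rL (b - c) ≤ ε ∧ ∀ δ > 0, b ∈ closure (nearCoincidence H δ) := by
  obtain ⟨R, hR0, hR⟩ := exists_norm_sub_le hH hq (by
    obtain ⟨p, hp, h⟩ := hN c 1 one_pos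
    exact ⟨p, hp, by linarith [rL_nonneg (p.1 - c)]⟩) c
  -- The final error is η² + 4·R·8η + 2·(8η)², at most (129 + 32R)η when η ≤ 1.
  set η := min 1 (ε / (129 + 32 * R))
  have hη : 0 < η := lt_min one_pos (by positivity)
  have hη1 : η ≤ 1 := min_le_left _ _
  have hηε : η * (129 + 32 * R) ≤ ε := by
    rw [← le_div_iff₀ (by positivity)]; exact min_le_right _ _
  obtain ⟨p, hp, hlt, b, hb, hcl⟩ := exists_near_limit hH hq hN c hη
  refine ⟨b, ?_, hcl⟩
  have hη2 : η ^ 2 ≤ η := by nlinarith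
  have h1 := hq p hp
  have h2 := rL_nonneg (p.1 - c)
  have hn := hR p hp (by linarith) (by linarith)
  have h3 := rL_add_le (p.1 - c) (b - p.1)
  rw [add_comm (p.1 - c), sub_add_sub_cancel] at h3
  have h4 : ‖p.1 - c‖ * ‖b - p.1‖ ≤ R * (8 * η) := mul_le_mul hn hb (norm_nonneg _) hR0
  have h5 : ‖b - p.1‖ ^ 2 ≤ (8 * η) ^ 2 := pow_le_pow_left₀ (norm_nonneg _) hb 2
  nlinarith

end NearCoincidence

/-! ### The sum of two multifunctions -/

namespace Multifunction

variable {E : Type*} [NormedAddCommGroup E] [NormedSpace ℝ E]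

/-- The points `((x, u + v), s + t)` with `φ_S(x, u) ≤ s` and `φ_T(x, v) ≤ t`. -/
def sumEpi (S T : Multifunction E) : Set ((E × StrongDual ℝ E) × ℝ) :=
  {p | ∃ u v s t, ((p.1.1, u), s) ∈ S.fitzEpi ∧ ((p.1.1, v), t) ∈ T.fitzEpi ∧
    p.1.2 = u + v ∧ p.2 = s + t}

theorem convex_sumEpi (S T : Multifunction E) : Convex ℝ (sumEpi S T) := by
  rintro p ⟨u, v, s, t, h1, h2, h3, h4⟩ p' ⟨u', v', s', t', h1', h2', h3', h4'⟩ α β hα hβ hαβ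
  refine ⟨α • u + β • u', α • v + β • v', α * s + β * s', α * t + β * t',
    S.convex_fitzEpi h1 h1' hα hβ hαβ, T.convex_fitzEpi h2 h2' hα hβ hαβ, ?_, ?_⟩
  · simp only [Prod.fst_add, Prod.smul_fst, Prod.snd_add, Prod.smul_snd, h3, h3', smul_add]
    abel
  · simp only [Prod.snd_add, Prod.smul_snd, h4, h4', smul_eq_mul]
    ring

theorem qL_le_of_mem_sumEpi {S T : Multifunction E} (hS : S.IsQuasidense) (hT : T.IsQuasidense) :
    ∀ p ∈ sumEpi S T, qL p.1 ≤ p.2 := by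
  rintro ⟨⟨x, w⟩, r⟩ ⟨u, v, s, t, h1, h2, h3, h4⟩
  dsimp only at *
  subst h3 h4
  have h5 := hS.qL_le h1
  have h6 := hT.qL_le h2
  simp only [qL, add_apply] at *
  linarith

/-- The indefinite quadratic parts cancel, leaving squared norms plus an affine function. -/
theorem convexOn_rL_sub_sub_qL (c : E × StrongDual ℝ E) :
    ConvexOn ℝ Set.univ fun b => rL (b - c) - qL b := by
  have hsq : ∀ {V : Type _} [NormedAddCommGroup V] [NormedSpace ℝ V] (x y : V) {α β : ℝ},
      0 ≤ α → 0 ≤ β → α + β = 1 → ‖α • x + β • y‖ ^ 2 ≤ α * ‖x‖ ^ 2 + β * ‖y‖ ^ 2 := by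
    intro V _ _ x y α β hα hβ hαβ
    have h := norm_add_le (α • x) (β • y)
    rw [norm_smul, norm_smul, Real.norm_of_nonneg hα, Real.norm_of_nonneg hβ] at h
    refine (pow_le_pow_left₀ (norm_nonneg _) h 2).trans ?_
    obtain rfl : β = 1 - α := by linarith
    nlinarith [mul_nonneg (mul_nonneg hα hβ) (sq_nonneg (‖x‖ - ‖y‖))]
  have hform : ∀ b : E × StrongDual ℝ E, rL (b - c) - qL b =
      1 / 2 * ‖(b - c).1‖ ^ 2 + 1 / 2 * ‖(b - c).2‖ ^ 2 + (qL c - (b.2 c.1 + c.2 b.1)) :=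
    fun b => by rw [rL, qL_sub]; ring
  refine ⟨convex_univ, fun x _ y _ α β hα hβ hαβ => ?_⟩
  have e : α • x + β • y - c = α • (x - c) + β • (y - c) := by
    rw [smul_sub, smul_sub, sub_add_sub_comm, ← add_smul, hαβ, one_smul]
  dsimp only
  rw [hform, hform, hform, e]
  have h1 := hsq (x - c).1 (y - c).1 hα hβ hαβ
  have h2 := hsq (x - c).2 (y - c).2 hα hβ hαβ
  simp only [Prod.fst_add, Prod.smul_fst, Prod.snd_add, Prod.smul_snd, smul_eq_mul, map_add,
    map_smul, add_apply, smul_apply] at *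
  linear_combination 1 / 2 * h1 + 1 / 2 * h2 - qL c * hαβ

section Sum

variable [CompleteSpace E] {S T : Multifunction E} (F : Submodule ℝ E)

theorem exists_mem_sumEpi_lt (hSq : S.IsQuasidense) (hSm : S.IsMonotone)
    (hTq : T.IsQuasidense) (hTm : T.IsMonotone) (hFc : IsClosed (F : Set E))
    (hF : (⋃ (c : ℝ) (_ : 0 < c), c • (S.fitzDom - T.fitzDom)) = (F : Set E))
    (c : E × StrongDual ℝ E) {ε : ℝ} (hε : 0 < ε) :
    ∃ p ∈ sumEpi S T, p.2 - qL p.1 + rL (p.1 - c) < ε := by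
  by_contra! hcon
  obtain ⟨z, y, y', h⟩ := exists_multipliers hSm hTm F hFc hF (convexOn_rL_sub_sub_qL c)
    ((continuous_rL.comp (continuous_id.sub continuous_const)).sub continuous_qL) ε (by
      intro x u v s t hs ht
      have := hcon ((x, u + v), s + t) ⟨u, v, s, t, hs, ht, rfl, rfl⟩
      dsimp only at this
      linarith)
  have hε4 : 0 < ε / 4 := by positivity
  -- NI is applied to S at (z, y') and to T at (y - z, y'), so `z` drops out of the sum. With `e`
  -- and `e'` near-optimal, what remains is ½‖f‖² + ½‖f'‖² + f' f < 0 for f = y - c.2 and f' = y' -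
  -- ĉ.1, which is impossible.
  obtain ⟨a, ha, hlt⟩ := Quasidense.exists_qL_sub_lt hSq z y' hε4
  obtain ⟨a', ha', hlt'⟩ := Quasidense.exists_qL_sub_lt hTq (y - z) y' hε4
  obtain ⟨e, he⟩ := exists_half_norm_sq_add_lt (y - c.2) hε4
  obtain ⟨e', he'⟩ := exists_half_norm_sq_add_lt
    (y' - NormedSpace.inclusionInDoubleDual ℝ E c.1) hε4
  have h1 := h a ha a' ha' (c + (e, e'))
  have h2 := (abs_le.1 ((y' - NormedSpace.inclusionInDoubleDual ℝ E c.1).le_opNorm (y - c.2) :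
    |_| ≤ _)).1
  have h3 := sq_nonneg
    (‖y - c.2‖ - ‖y' - NormedSpace.inclusionInDoubleDual ℝ E c.1‖)
  simp only [rL, qL, add_sub_cancel_left, Prod.fst_add, Prod.snd_add, map_add, map_sub,
    sub_apply, add_apply, NormedSpace.dual_def] at *
  nlinarith

theorem mem_graph_add (hSc : S.IsClosedGraph) (hSq : S.IsQuasidense) (hSm : S.IsMonotone)
    (hTc : T.IsClosedGraph) (hTq : T.IsQuasidense) (hTm : T.IsMonotone)
    (hFc : IsClosed (F : Set E))
    (hF : (⋃ (c : ℝ) (_ : 0 < c), c • (S.fitzDom - T.fitzDom)) = (F : Set E))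
    {b : E × StrongDual ℝ E} (hb : ∀ δ > 0, b ∈ closure (nearCoincidence (sumEpi S T) δ)) :
    b ∈ (S + T).graph := by
  have hzero : ∀ {V : Type _} [NormedAddCommGroup V] [NormedSpace ℝ V] (f : StrongDual ℝ V)
      (C : ℝ), (∀ x, f x ≤ C) → f = 0 := by
    intro V _ _ f C hC
    ext x
    by_contra hx
    have := hC (((C + 1) / f x) • x)
    rw [map_smul, smul_eq_mul, div_mul_cancel₀ _ hx] at this
    linarith
  -- Here `g` is linear and the test point is unrestricted, so boundedness forces y = b.2 and y' =
  -- b.1 in the bidual. Only the splitting functional `z` stays undetermined.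
  obtain ⟨z, y, y', h⟩ := exists_multipliers hSm hTm F hFc hF
    (g := fun d => -(d.2 b.1 + b.2 d.1))
    ⟨convex_univ, fun d _ d' _ α β _ _ _ => le_of_eq (by simp; ring)⟩ (by fun_prop) (-qL b) (by
      intro x u v s t hs ht
      have := pairing_sub_qL_le (convex_sumEpi S T) (qL_le_of_mem_sumEpi hSq hTq) hb
        (p := ((x, u + v), s + t)) ⟨u, v, s, t, hs, ht, rfl, rfl⟩
      dsimp only at *
      linarith)
  obtain ⟨a₀, ha₀⟩ := hSq.graph_nonempty
  obtain ⟨a₁, ha₁⟩ := hTq.graph_nonempty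
  set C := qL a₀ + qL a₁ + qL b - z (a₀.1 - a₁.1) - y a₁.1 - y' (a₀.2 + a₁.2) with hC
  have hy : b.2 - y = 0 := hzero _ C fun x => by
    have := h a₀ ha₀ a₁ ha₁ (x, 0)
    simp only [map_sub, sub_apply, map_add, sub_zero, zero_apply] at *
    linarith
  have hy' : NormedSpace.inclusionInDoubleDual ℝ E b.1 - y' = 0 := hzero _ C fun x => by
    have := h a₀ ha₀ a₁ ha₁ (0, x)
    simp only [map_sub, sub_apply, map_add, sub_zero, map_zero, NormedSpace.dual_def] at *
    linarith
  have hy2 : ∀ w, y' w = w b.1 := fun w => by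
    rw [← sub_eq_zero.1 hy', NormedSpace.dual_def]
  have key : ∀ a ∈ S.graph, ∀ a' ∈ T.graph, 0 ≤ qL (a - (b.1, z)) + qL (a' - (b.1, b.2 - z)) := by
    intro a ha a' ha'
    have := h a ha a' ha' 0
    rw [hy2, ← sub_eq_zero.1 hy] at this
    rw [qL_sub, qL_sub]
    simp only [qL, map_sub, sub_apply, add_apply, Prod.fst_zero, Prod.snd_zero, map_zero,
      zero_apply, sub_zero, add_zero, neg_zero] at *
    linarith
  -- The two terms of `key` vary independently and each can be made smaller than any ε > 0, so the
  -- other is nonnegative.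
  have hS : (b.1, z) ∈ S.graph := Quasidense.mem_of_forall_qL_nonneg hSq hSc fun a ha => by
    refine le_of_forall_pos_le_add fun ε hε => ?_
    obtain ⟨a', ha', hlt⟩ := Quasidense.exists_qL_lt hTq (b.1, b.2 - z) hε
    linarith [key a ha a' ha']
  have hT : (b.1, b.2 - z) ∈ T.graph := Quasidense.mem_of_forall_qL_nonneg hTq hTc fun a' ha' => by
    refine le_of_forall_pos_le_add fun ε hε => ?_
    obtain ⟨a, ha, hlt⟩ := Quasidense.exists_qL_lt hSq (b.1, z) hε
    linarith [key a ha a' ha']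
  exact Set.mem_add.2 ⟨z, hS, b.2 - z, hT, add_sub_cancel _ _⟩

omit [CompleteSpace E] in
theorem graph_add_subset_nearCoincidence (hSm : S.IsMonotone) (hTm : T.IsMonotone) {δ : ℝ}
    (hδ : 0 ≤ δ) : (S + T).graph ⊆ nearCoincidence (sumEpi S T) δ := by
  rintro ⟨x, w⟩ hw
  obtain ⟨u, hu, v, hv, rfl⟩ := Set.mem_add.1 (show w ∈ S x + T x from hw)
  refine ⟨_, ⟨u, v, _, _, hSm.mem_fitzEpi (a := (x, u)) hu, hTm.mem_fitzEpi (a := (x, v)) hv,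
    rfl, rfl⟩, ?_⟩
  simpa [qL] using hδ

omit [CompleteSpace E] in
theorem IsMonotone.add (hSm : S.IsMonotone) (hTm : T.IsMonotone) : (S + T).IsMonotone := by
  rintro ⟨x, w⟩ hw ⟨x', w'⟩ hw'
  obtain ⟨u, hu, v, hv, rfl⟩ := Set.mem_add.1 (show w ∈ S x + T x from hw)
  obtain ⟨u', hu', v', hv', rfl⟩ := Set.mem_add.1 (show w' ∈ S x' + T x' from hw')
  have h1 := hSm (x, u) hu (x', u') hu'
  have h2 := hTm (x, v) hv (x', v') hv'
  simp only [qL, Prod.mk_sub_mk, sub_apply, add_apply] at *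
  linarith

end Sum


theorem iUnion_smul_eq_univ_of_mem_nhds {A : Set E} (hA : A ∈ nhds (0 : E)) :
    (⋃ (c : ℝ) (_ : 0 < c), c • A) = Set.univ := by
  refine Set.eq_univ_of_forall fun x => ?_
  obtain ⟨c, hc, h⟩ := ((absorbent_nhds_zero (𝕜 := ℝ) hA) x).exists_pos
  simp only [Set.mem_iUnion]
  exact ⟨c, hc, h c (by simp [abs_of_pos hc]) rfl⟩

end Multifunction

/-! ### The chain of implications -/

theorem theorem7p2 {E : Type*} [NormedAddCommGroup E] [NormedSpace ℝ E] [CompleteSpace E]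
    (S T : Multifunction E)
    (hSc : S.IsClosedGraph) (hSq : S.IsQuasidense) (hSm : S.IsMonotone)
    (hTc : T.IsClosedGraph) (hTq : T.IsQuasidense) (hTm : T.IsMonotone) :
    -- (a) implies (b)
    (((S.domain ∩ interior T.domain).Nonempty ∨ (interior S.domain ∩ T.domain).Nonempty) →
      (⋃ (c : ℝ) (_ : 0 < c), c • (S.domain - T.domain)) = Set.univ) ∧
    -- (b) implies (c)
    ((⋃ (c : ℝ) (_ : 0 < c), c • (S.domain - T.domain)) = Set.univ →
      ∃ F : Submodule ℝ E, IsClosed (F : Set E) ∧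
        (⋃ (c : ℝ) (_ : 0 < c), c • (Prod.fst '' effDom S.fitzpatrick -
          Prod.fst '' effDom T.fitzpatrick)) = (F : Set E)) ∧
    -- (c) implies (d)
    ((∃ F : Submodule ℝ E, IsClosed (F : Set E) ∧
        (⋃ (c : ℝ) (_ : 0 < c), c • (Prod.fst '' effDom S.fitzpatrick -
          Prod.fst '' effDom T.fitzpatrick)) = (F : Set E)) →
      (S + T).IsClosedGraph ∧ (S + T).IsQuasidense ∧ (S + T).IsMonotone) := by
  rw [Multifunction.fst_image_effDom_fitzpatrick hSq.graph_nonempty,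
    Multifunction.fst_image_effDom_fitzpatrick hTq.graph_nonempty]
  refine ⟨?_, fun h => ?_, ?_⟩
  · intro h
    apply Multifunction.iUnion_smul_eq_univ_of_mem_nhds
    rcases h with ⟨x, hS, hT⟩ | ⟨x, hS, hT⟩
    · have hc : Filter.Tendsto (fun e => x - e) (nhds 0) (nhds x) := by
        exact Continuous.tendsto' (by fun_prop) _ _ (by simp)
      filter_upwards [hc (mem_interior_iff_mem_nhds.1 hT)] with e he
      exact Set.mem_sub.2 ⟨x, hS, x - e, he, sub_sub_cancel _ _⟩
    · have hc : Filter.Tendsto (fun e => x + e) (nhds 0) (nhds x) := by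
        exact Continuous.tendsto' (by fun_prop) _ _ (by simp)
      filter_upwards [hc (mem_interior_iff_mem_nhds.1 hS)] with e he
      exact Set.mem_sub.2 ⟨x + e, he, x, hT, add_sub_cancel_left _ _⟩
  -- Each domain lies in the projected Fitzpatrick domain, so the larger union is also all of E.
  · refine ⟨⊤, isClosed_univ, ?_⟩
    rw [Submodule.top_coe, ← Set.univ_subset_iff, ← h]
    exact Set.iUnion₂_mono fun c _ => Set.smul_set_mono
      (Set.sub_subset_sub hSm.domain_subset_fitzDom hTm.domain_subset_fitzDom)
  · rintro ⟨F, hFc, hF⟩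
    refine ⟨isClosed_of_closure_subset fun b hb => ?_,
      quasidense_of_forall_exists fun c ε hε => ?_, hSm.add hTm⟩
    · exact Multifunction.mem_graph_add F hSc hSq hSm hTc hTq hTm hFc hF fun δ hδ =>
        closure_mono (Multifunction.graph_add_subset_nearCoincidence hSm hTm hδ.le) hb
    · obtain ⟨b, hb, hcl⟩ := exists_rL_lt_of_near (Multifunction.convex_sumEpi S T)
        (Multifunction.qL_le_of_mem_sumEpi hSq hTq)
        (fun c ε hε => Multifunction.exists_mem_sumEpi_lt F hSq hSm hTq hTm hFc hF c hε) c hε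
      exact ⟨b, Multifunction.mem_graph_add F hSc hSq hSm hTc hTq hTm hFc hF hcl, hb⟩
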